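/- Let $k$ be an algebraically closed field of characteristic not equal to $2$, and let $D(\Lambda_2)$ be the Drinfel'd double of the Taft algebra for $n=2$, i.e. the $k$-algebra generated by $x, X, g, G$ subject to the relations $$x^2=0,\quad X^2=0,\quad g^2=1,\quad G^2=1,\quad gG=Gg,\quad gx=-xg,\quad gX=-Xg,\quad Gx=-xG,\quad GX=-XG,\quad xX+Xx=1-gG.$$ Let $k$ also denote the trivial left $D(\Lambda_2)$-module (one-dimensional, $g$ and $G$ act as $1$, $x$ and $X$ act as $0$), and let $k_-$ be the one-dimensional left $D(\Lambda_2)$-module on which $g$ and $G$ act as $-1$ and $x$ and $X$ act as $0$. For $D(\Lambda_2)$-modules $M,N$ put $\operatorname{Ext}^*(M,N)=\bigoplus_{n\ge 0}\operatorname{Ext}^n_{D(\Lambda_2)}(M,N)$, regarded through the Yoneda product as a left module over the ring $\operatorname{Ext}^*(N,N)$ and as a right module over the ring $\operatorname{Ext}^*(M,M)$. Then: 1. $\operatorname{Ext}^*(k,k_-)$ is generated by $\operatorname{Ext}^1(k,k_-)$ as a left $\operatorname{Ext}^*(k_-,k_-)$-module, and it is also generated by $\operatorname{Ext}^1(k,k_-)$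 as a right $\operatorname{Ext}^*(k,k)$-module. 2. $\operatorname{Ext}^*(k_-,k)$ is generated by $\operatorname{Ext}^1(k_-,k)$ as a left $\operatorname{Ext}^*(k,k)$-module, and it is also generated by $\operatorname{Ext}^1(k_-,k)$ as a right $\operatorname{Ext}^*(k_-,k_-)$-module. -/

import Mathlib

open CategoryTheory CategoryTheory.Abelian
open scoped DirectSum

universe w v u

/-! ### The graded group `Ext*(X, Y)` with the Yoneda product -/

section YonedaExt

variable {C : Type u} [Category.{v} C] [Abelian C] [HasExt.{w} C]

/-- `Ext*(X, Y) = ⨁ₙ Extⁿ(X, Y)` in an abelian category. -/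
def ExtStar (X Y : C) : Type w := ⨁ n : ℕ, Ext.{w} X Y n

namespace ExtStar

noncomputable instance (X Y : C) : AddCommGroup (ExtStar X Y) :=
  inferInstanceAs (AddCommGroup (⨁ n : ℕ, Ext.{w} X Y n))

/-- The inclusion of the homogeneous component `Extⁿ(X, Y)` into `Ext*(X, Y)`. -/
noncomputable def of (X Y : C) (n : ℕ) : Ext.{w} X Y n →+ ExtStar X Y :=
  DirectSum.of (fun n : ℕ => Ext.{w} X Y n) n

/-- The additive map out of `Ext*(X, Y)` with given homogeneous components. -/
noncomputable def lift {X Y : C} {M : Type*} [AddCommMonoid M] (f : ∀ n, Ext.{w} X Y n →+ M) :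
    ExtStar X Y →+ M :=
  DirectSum.toAddMonoid f

@[simp]
lemma lift_of {X Y : C} {M : Type*} [AddCommMonoid M] (f : ∀ n, Ext.{w} X Y n →+ M) (n : ℕ)
    (α : Ext.{w} X Y n) : lift f (of X Y n α) = f n α :=
  DirectSum.toAddMonoid_of f n α

/-- The Yoneda product `Ext*(Y, Z) × Ext*(X, Y) → Ext*(X, Z)`, `(α, β) ↦ α ∘ β`; it is biadditive
and on homogeneous elements it is the composition of extension classes
(which `Ext.comp` writes in the opposite order). -/
noncomputable def yoneda (X Y Z : C) : ExtStar Y Z →+ ExtStar X Y →+ ExtStar X Z :=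
  lift fun a => AddMonoidHom.flip <| lift fun b =>
    AddMonoidHom.mk' (fun β => AddMonoidHom.mk'
      (fun α => of X Z (a + b) (Ext.comp β α (add_comm b a)))
      (fun α₁ α₂ => by rw [Ext.comp_add, map_add]))
      (fun β₁ β₂ => by ext α; simp [Ext.add_comp])

lemma yoneda_of_of {X Y Z : C} {a b : ℕ} (α : Ext.{w} Y Z a) (β : Ext.{w} X Y b) :
    yoneda X Y Z (of Y Z a α) (of X Y b β) = of X Z (a + b) (β.comp α (add_comm b a)) := by
  simp [yoneda]

@[elab_as_elim]
lemma induction {X Y : C} {p : ExtStar X Y → Prop} (x : ExtStar X Y) (zero : p 0)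
    (of : ∀ n (α : Ext.{w} X Y n), p (of X Y n α)) (add : ∀ x y, p x → p y → p (x + y)) : p x :=
  DirectSum.induction_on x zero of add

lemma of_comp_congr {X Y Z : C} {a b c c' : ℕ} (α : Ext.{w} X Y a) (β : Ext.{w} Y Z b)
    (h : a + b = c) (h' : a + b = c') : of X Z c (α.comp β h) = of X Z c' (α.comp β h') := by
  subst h
  subst h'
  rfl

lemma yoneda_assoc {X Y Z T : C} (α : ExtStar Z T) (β : ExtStar Y Z) (γ : ExtStar X Y) :
    yoneda X Y T (yoneda Y Z T α β) γ = yoneda X Z T α (yoneda X Y Z β γ) := by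
  induction α using induction with
  | zero => simp
  | add x y hx hy => simp [hx, hy]
  | of a α =>
    induction β using induction with
    | zero => simp
    | add x y hx hy => simp [hx, hy]
    | of b β =>
      induction γ using induction with
      | zero => simp
      | add x y hx hy => simp [hx, hy]
      | of c γ =>
        simp only [yoneda_of_of]
        rw [← Ext.comp_assoc γ β α (add_comm c b) (add_comm b a) (by omega)]
        exact of_comp_congr _ _ _ _

/-- The identity class in `Ext⁰(X, X)`. -/
noncomputable def one (X : C) : ExtStar X X := of X X 0 (Ext.mk₀ (𝟙 X))

lemma one_yoneda {X Y : C} (β : ExtStar X Y) : yoneda X Y Y (one Y) β = β := by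
  induction β using induction with
  | zero => simp
  | add x y hx hy => simp [hx, hy]
  | of b β =>
    rw [one, yoneda_of_of, of_comp_congr _ _ _ (add_zero b), Ext.comp_mk₀_id]

lemma yoneda_one {X Y : C} (α : ExtStar X Y) : yoneda X X Y α (one X) = α := by
  induction α using induction with
  | zero => simp
  | add x y hx hy => simp [hx, hy]
  | of a α =>
    rw [one, yoneda_of_of, of_comp_congr _ _ _ (zero_add a), Ext.mk₀_id_comp]

/-- The Yoneda algebra `Ext*(X, X)`. -/
noncomputable instance (X : C) : Ring (ExtStar X X) :=
  { (inferInstance : AddCommGroup (ExtStar X X)) with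
    mul := fun α β => yoneda X X X α β
    one := one X
    mul_assoc := yoneda_assoc
    one_mul := one_yoneda
    mul_one := yoneda_one
    left_distrib := fun α β γ => map_add (yoneda X X X α) β γ
    right_distrib := fun α β γ => by
      change yoneda X X X (α + β) γ = yoneda X X X α γ + yoneda X X X β γ
      simp
    zero_mul := fun α => by
      change yoneda X X X 0 α = 0
      simp
    mul_zero := fun α => map_zero (yoneda X X X α) }

/-- `Ext*(X, Y)` is a left `Ext*(Y, Y)`-module: `α • β = α ∘ β`. -/
noncomputable instance leftModule (X Y : C) : Module (ExtStar Y Y) (ExtStar X Y) where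
  smul α β := yoneda X Y Y α β
  one_smul := one_yoneda
  mul_smul := yoneda_assoc
  smul_zero α := map_zero (yoneda X Y Y α)
  smul_add α := map_add (yoneda X Y Y α)
  add_smul α α' β := by
    change yoneda X Y Y (α + α') β = yoneda X Y Y α β + yoneda X Y Y α' β
    simp
  zero_smul β := by
    change yoneda X Y Y 0 β = 0
    simp

/-- `Ext*(X, Y)` is a right `Ext*(X, X)`-module, that is, a left module over the opposite ring:
`op γ • β = β ∘ γ`. -/
noncomputable instance rightModule (X Y : C) : Module (ExtStar X X)ᵐᵒᵖ (ExtStar X Y) where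
  smul γ β := yoneda X X Y β γ.unop
  one_smul := yoneda_one
  mul_smul γ γ' β := (yoneda_assoc β γ'.unop γ.unop).symm
  smul_zero γ := by
    change yoneda X X Y 0 γ.unop = 0
    simp
  smul_add γ β β' := by
    change yoneda X X Y (β + β') γ.unop = yoneda X X Y β γ.unop + yoneda X X Y β' γ.unop
    simp
  add_smul γ γ' β := map_add (yoneda X X Y β) γ.unop γ'.unop
  zero_smul β := map_zero (yoneda X X Y β)

end ExtStar

end YonedaExt

/-! ### The Drinfel'd double of the Taft algebra for `n = 2` -/

namespace TaftDouble

/-- The four generators. -/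
inductive Gen : Type
  | x | X | g | G

section

variable (k : Type u) [Field k]

/-- The free algebra `k⟨x, X, g, G⟩`. -/
abbrev Free : Type u := FreeAlgebra k Gen

/-- A generator as an element of the free algebra. -/
abbrev gen (s : Gen) : Free k := FreeAlgebra.ι k s

/-- The defining relations. -/
inductive Rel : Free k → Free k → Prop
  | x_sq : Rel (gen k .x * gen k .x) 0
  | X_sq : Rel (gen k .X * gen k .X) 0
  | g_sq : Rel (gen k .g * gen k .g) 1
  | G_sq : Rel (gen k .G * gen k .G) 1
  | gG : Rel (gen k .g * gen k .G) (gen k .G * gen k .g)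
  | gx : Rel (gen k .g * gen k .x) (-(gen k .x * gen k .g))
  | gX : Rel (gen k .g * gen k .X) (-(gen k .X * gen k .g))
  | Gx : Rel (gen k .G * gen k .x) (-(gen k .x * gen k .G))
  | GX : Rel (gen k .G * gen k .X) (-(gen k .X * gen k .G))
  | xX : Rel (gen k .x * gen k .X + gen k .X * gen k .x) (1 - gen k .g * gen k .G)

end

end TaftDouble

/-- The algebra `D(Λ₂)` given by generators and relations. -/
abbrev TaftDouble (k : Type u) [Field k] : Type u := RingQuot (TaftDouble.Rel k)

namespace TaftDouble

section

variable (k : Type u) [Field k]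

/-- For `ε² = 1`, the algebra homomorphism `D(Λ₂) → k` with `x, X ↦ 0` and `g, G ↦ ε`. -/
def character (ε : k) (hε : ε * ε = 1) : TaftDouble k →ₐ[k] k :=
  RingQuot.liftAlgHom k ⟨FreeAlgebra.lift k fun
    | .x => 0
    | .X => 0
    | .g => ε
    | .G => ε, by
      intro a b h
      cases h <;> simp [hε]⟩

/-- The counit of `D(Λ₂)`: `x, X ↦ 0` and `g, G ↦ 1`. -/
def counit : TaftDouble k →ₐ[k] k := character k 1 (by simp)

/-- The trivial `D(Λ₂)`-module: `k`, with `D(Λ₂)` acting through the counit. -/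
noncomputable def triv : ModuleCat.{u} (TaftDouble k) :=
  (ModuleCat.restrictScalars (counit k).toRingHom).obj (ModuleCat.of k k)

/-- The one-dimensional `D(Λ₂)`-module `k₋`: `k`, with `g, G` acting as `-1` and `x, X` as `0`. -/
noncomputable def kMinus : ModuleCat.{u} (TaftDouble k) :=
  (ModuleCat.restrictScalars (character k (-1) (by simp)).toRingHom).obj (ModuleCat.of k k)

end

end TaftDouble

/-!
Write `k_ε` for the one-dimensional module on which `g` and `G` act as `ε = ±1`. When `2 ≠ 0` in
`k`, its projective cover `P_ε` has the basis `v, x v, X v, x X v`, and `k_ε` is the top of two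
two-dimensional quotients of `P_ε`, namely `U_ε = ⟨v, x v⟩` and `V_ε = ⟨v, X v⟩`, both of which are
extensions of `k_ε` by `k_{-ε}`. The kernel of `P_ε → U_ε` is `U_{-ε}`, generated by `X v`, and
`P_ε → V_ε` restricts to the projection `U_{-ε} → k_{-ε}`.

Let `x` act as zero on `T`. Dimension shifting along `P_ε` shows by induction on `n` that
`Extⁿ(k_ε, T) → Extⁿ(U_ε, T)` is onto, and that `Extⁿ⁺¹(U_ε, T)` consists of the pullbacks of the
classes `γ ∘ [V_ε]` with `γ` in `Extⁿ(k_{-ε}, T)`. The long exact sequence of `U_ε` then gives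
`Extⁿ⁺¹(k_ε, T) = Extⁿ(k_{-ε}, T) ∘ [U_ε] + Extⁿ(k_{-ε}, T) ∘ [V_ε]`.
-/

section LongExactSequence

variable {C : Type u} [Category.{v} C] [Abelian C] [HasExt.{w} C]

/-- Dimension shifting along `S₁`, combined with the fact that the pushout of the class of `S₁`
along `φ.τ₁` is the pullback of the class of `S₂` along `φ.τ₃`. -/
lemma precomp_extClass_surjective_of_projective {S₁ S₂ : ShortComplex C} (h₁ : S₁.ShortExact)
    (h₂ : S₂.ShortExact) (φ : S₁ ⟶ S₂) [Projective S₁.X₂] {T : C} {n : ℕ}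
    (hφ : Function.Surjective ((Ext.mk₀.{w} φ.τ₁).precomp T (zero_add n))) :
    Function.Surjective ((Ext.mk₀.{w} φ.τ₃).precomp T (zero_add (n + 1)) ∘
      h₂.extClass.precomp T (add_comm 1 n)) := by
  intro α
  obtain ⟨δ, rfl⟩ : ∃ δ : Ext S₁.X₁ T n, h₁.extClass.comp δ (add_comm 1 n) = α :=
    Ext.contravariant_sequence_exact₃ h₁ T α (Ext.eq_zero_of_projective _) (add_comm 1 n)
  obtain ⟨β, rfl⟩ := hφ δ
  refine ⟨β, ?_⟩
  calc (Ext.mk₀ φ.τ₃).comp (h₂.extClass.comp β (add_comm 1 n)) (zero_add _)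
      = ((Ext.mk₀ φ.τ₃).comp h₂.extClass (zero_add 1)).comp β (add_comm 1 n) :=
        (Ext.comp_assoc _ _ _ _ _ (by omega)).symm
    _ = (h₁.extClass.comp (Ext.mk₀ φ.τ₁) (add_zero 1)).comp β (add_comm 1 n) := by
        rw [ShortComplex.ShortExact.extClass_naturality h₁ h₂ φ]
    _ = h₁.extClass.comp ((Ext.mk₀ φ.τ₁).comp β (zero_add n)) (add_comm 1 n) :=
        Ext.comp_assoc _ _ _ _ _ (by omega)

lemma exists_eq_extClass_comp_add_comp {S : ShortComplex C} (hS : S.ShortExact) {N T : C} {n : ℕ}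
    (c : Ext.{w} S.X₃ N 1)
    (hc : Function.Surjective ((Ext.mk₀.{w} S.g).precomp T (zero_add (n + 1)) ∘
      c.precomp T (add_comm 1 n))) (α : Ext.{w} S.X₃ T (n + 1)) :
    ∃ (β : Ext.{w} S.X₁ T n) (γ : Ext.{w} N T n),
      hS.extClass.comp β (add_comm 1 n) + c.comp γ (add_comm 1 n) = α := by
  obtain ⟨γ, hγ⟩ := hc ((Ext.mk₀ S.g).comp α (zero_add _))
  have hker : (Ext.mk₀ S.g).comp (α - c.comp γ (add_comm 1 n)) (zero_add _) = 0 :=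
    (map_sub ((Ext.mk₀ S.g).precomp T (zero_add (n + 1))) _ _).trans (sub_eq_zero.2 hγ.symm)
  obtain ⟨β, hβ⟩ := Ext.contravariant_sequence_exact₃ hS T _ hker (add_comm 1 n)
  exact ⟨β, γ, by rw [hβ, sub_add_cancel]⟩

end LongExactSequence

section Generation

variable {C : Type u} [Category.{v} C] [Abelian C] [HasExt.{w} C]

/-- The positive part of `Ext*(M, T)` is generated by Yoneda products of classes of `Ext*(N, T)`
with classes of `Ext¹(M, N)`. -/
def FactorsThroughExtOne (M N T : C) : Prop :=
  ∀ n : ℕ, AddSubgroup.closure {α : Ext.{w} M T (n + 1) |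
    ∃ (a : Ext.{w} M N 1) (β : Ext.{w} N T n), a.comp β (add_comm 1 n) = α} = ⊤

lemma FactorsThroughExtOne.of_mem {M N T : C} (h : FactorsThroughExtOne.{w} M N T) {n : ℕ}
    {K : AddSubgroup (ExtStar M T)}
    (hK : ∀ (a : Ext.{w} M N 1) (β : Ext.{w} N T n),
      ExtStar.yoneda M N T (ExtStar.of N T n β) (ExtStar.of M N 1 a) ∈ K)
    (α : Ext.{w} M T (n + 1)) : ExtStar.of M T (n + 1) α ∈ K := by
  suffices (⊤ : AddSubgroup (Ext.{w} M T (n + 1))) ≤ K.comap (ExtStar.of M T (n + 1)) from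
    this (AddSubgroup.mem_top α)
  rw [← h n, AddSubgroup.closure_le]
  rintro _ ⟨a, β, rfl⟩
  exact AddSubgroup.mem_comap.2 (by simpa only [ExtStar.yoneda_of_of] using hK a β)

namespace ExtStar

lemma submodule_eq_top_of_forall_of_mem {R : Type*} [Semiring R] {X Y : C}
    [Module R (ExtStar X Y)] {K : Submodule R (ExtStar X Y)}
    (hK : ∀ (n : ℕ) (α : Ext.{w} X Y n), of X Y n α ∈ K) : K = ⊤ := by
  refine Submodule.eq_top_iff'.2 fun x => ?_
  induction x using induction with
  | zero => exact zero_mem K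
  | of n α => exact hK n α
  | add x y hx hy => exact add_mem hx hy

lemma of_zero_eq_zero {M N : C} (h₀ : ∀ f : M ⟶ N, f = 0) (α : Ext.{w} M N 0) :
    of M N 0 α = 0 := by
  obtain ⟨f, rfl⟩ := (Ext.mk₀_bijective M N).2 α
  rw [h₀ f, Ext.mk₀_zero, map_zero]

theorem span_left_range_of_one_eq_top {M N : C} (h₀ : ∀ f : M ⟶ N, f = 0)
    (h : FactorsThroughExtOne.{w} M N N) :
    Submodule.span (ExtStar N N) (Set.range (of M N 1)) = ⊤ := by
  refine submodule_eq_top_of_forall_of_mem fun n α => ?_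
  match n, α with
  | 0, α => exact of_zero_eq_zero h₀ α ▸ zero_mem _
  | n + 1, α =>
    exact h.of_mem (K := (Submodule.span (ExtStar N N) (Set.range (of M N 1))).toAddSubgroup)
      (fun a β => Submodule.smul_mem _ (of N N n β) (Submodule.subset_span ⟨a, rfl⟩)) α

/-- Splitting two classes of degree one off a class in `Extⁿ⁺²(M, N)` leaves a class in
`Extⁿ(M, N)` times a class in `Ext²(M, M)`. -/
lemma of_mem_span_right_range_of_one {M N : C} (h₀ : ∀ f : M ⟶ N, f = 0)
    (h : FactorsThroughExtOne.{w} M N N) (h' : FactorsThroughExtOne.{w} N M N) :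
    ∀ (n : ℕ) (α : Ext.{w} M N n),
      of M N n α ∈ Submodule.span (ExtStar M M)ᵐᵒᵖ (Set.range (of M N 1))
  | 0, α => of_zero_eq_zero h₀ α ▸ zero_mem _
  | 1, α => Submodule.subset_span ⟨α, rfl⟩
  | n + 2, α => by
    let K := (Submodule.span (ExtStar M M)ᵐᵒᵖ (Set.range (of M N 1))).toAddSubgroup
    refine h.of_mem (K := K) (fun a β => ?_) α
    refine h'.of_mem (K := K.comap ((yoneda M N N).flip (of M N 1 a))) (fun b γ => ?_) β
    change yoneda M N N (yoneda N M N (of M N n γ) (of N M 1 b)) (of M N 1 a) ∈ K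
    rw [yoneda_assoc]
    exact Submodule.smul_mem _ (MulOpposite.op (yoneda M N M (of N M 1 b) (of M N 1 a)))
      (of_mem_span_right_range_of_one h₀ h h' n γ)

theorem span_right_range_of_one_eq_top {M N : C} (h₀ : ∀ f : M ⟶ N, f = 0)
    (h : FactorsThroughExtOne.{w} M N N) (h' : FactorsThroughExtOne.{w} N M N) :
    Submodule.span (ExtStar M M)ᵐᵒᵖ (Set.range (of M N 1)) = ⊤ :=
  submodule_eq_top_of_forall_of_mem (of_mem_span_right_range_of_one h₀ h h')

end ExtStar

end Generation

section Representations

variable {k A : Type*} [CommRing k] [Ring A] [Algebra k A]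

/-- The `A`-module afforded by a representation of the `k`-algebra `A` on `W`. It is encoded by
restriction of scalars, so that it agrees definitionally with the one-dimensional modules `triv`
and `kMinus`. -/
noncomputable def moduleOfRep {W : Type w} [AddCommGroup W] [Module k W]
    (ρ : A →ₐ[k] Module.End k W) : ModuleCat.{w} A :=
  (ModuleCat.restrictScalars ρ.toRingHom).obj (ModuleCat.of (Module.End k W) W)

lemma comp_rep_eq_of_adjoin_eq_top {W W' : Type*} [AddCommGroup W] [Module k W]
    [AddCommGroup W'] [Module k W'] {ρ : A →ₐ[k] Module.End k W} {ρ' : A →ₐ[k] Module.End k W'}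
    {f : W →ₗ[k] W'} {s : Set A} (hs : Algebra.adjoin k s = ⊤)
    (hf : ∀ a ∈ s, f ∘ₗ ρ a = ρ' a ∘ₗ f) (a : A) : f ∘ₗ ρ a = ρ' a ∘ₗ f := by
  have ha : a ∈ Algebra.adjoin k s := hs ▸ Algebra.mem_top
  induction ha using Algebra.adjoin_induction with
  | mem a ha => exact hf a ha
  | algebraMap c => ext; simp
  | add a b _ _ ha hb => simp only [map_add, LinearMap.comp_add, LinearMap.add_comp, ha, hb]
  | mul a b _ _ ha hb =>
    rw [map_mul, map_mul, Module.End.mul_eq_comp, Module.End.mul_eq_comp, ← LinearMap.comp_assoc,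
      ha, LinearMap.comp_assoc, hb, LinearMap.comp_assoc]

variable {W W' : Type w} [AddCommGroup W] [Module k W] [AddCommGroup W'] [Module k W']

namespace moduleOfRep

/-- The morphism of modules given by an intertwiner of two representations. -/
noncomputable def map {ρ : A →ₐ[k] Module.End k W} {ρ' : A →ₐ[k] Module.End k W'} (f : W →ₗ[k] W')
    (hf : ∀ a, f ∘ₗ ρ a = ρ' a ∘ₗ f) : moduleOfRep ρ ⟶ moduleOfRep ρ' :=
  ModuleCat.ofHom (X := moduleOfRep ρ) (Y := moduleOfRep ρ')
    { toFun := f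
      map_add' := map_add f
      map_smul' := fun a => LinearMap.congr_fun (hf a) }

lemma map_comp_map_eq {W₁ W₂ W₃ W₄ : Type w} [AddCommGroup W₁] [Module k W₁] [AddCommGroup W₂]
    [Module k W₂] [AddCommGroup W₃] [Module k W₃] [AddCommGroup W₄] [Module k W₄]
    {ρ₁ : A →ₐ[k] Module.End k W₁} {ρ₂ : A →ₐ[k] Module.End k W₂} {ρ₃ : A →ₐ[k] Module.End k W₃}
    {ρ₄ : A →ₐ[k] Module.End k W₄} {f : W₁ →ₗ[k] W₂} {g : W₂ →ₗ[k] W₄} {f' : W₁ →ₗ[k] W₃}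
    {g' : W₃ →ₗ[k] W₄} (hf : ∀ a, f ∘ₗ ρ₁ a = ρ₂ a ∘ₗ f) (hg : ∀ a, g ∘ₗ ρ₂ a = ρ₄ a ∘ₗ g)
    (hf' : ∀ a, f' ∘ₗ ρ₁ a = ρ₃ a ∘ₗ f') (hg' : ∀ a, g' ∘ₗ ρ₃ a = ρ₄ a ∘ₗ g')
    (h : g ∘ₗ f = g' ∘ₗ f') : map f hf ≫ map g hg = map f' hf' ≫ map g' hg' :=
  ModuleCat.hom_ext (LinearMap.ext fun w => LinearMap.congr_fun h w)

end moduleOfRep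

/-- The operator `(v, w) ↦ (a v, n v + b w)`. -/
def lowerTriangular (a : Module.End k W) (n : W →ₗ[k] W') (b : Module.End k W') :
    Module.End k (W × W') :=
  (a ∘ₗ LinearMap.fst k W W').prod (n.coprod b)

@[simp]
lemma lowerTriangular_apply (a : Module.End k W) (n : W →ₗ[k] W') (b : Module.End k W')
    (v : W × W') : lowerTriangular a n b v = (a v.1, n v.1 + b v.2) := rfl

lemma rep_apply_rep_apply_eq_neg_smul {ρ : A →ₐ[k] Module.End k W} {a b : A}
    (hab : a * b = -(b * a)) {c : k} {m : W} (hm : ρ a m = c • m) :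
    ρ a (ρ b m) = -c • ρ b m := by
  rw [← Module.End.mul_apply, ← map_mul, hab, map_neg, map_mul, LinearMap.neg_apply,
    Module.End.mul_apply, hm, map_smul, neg_smul]

lemma hom_eq_zero_of_isUnit_sub {M N : ModuleCat.{w} A} {a : A} {c d : k}
    (hM : ∀ m : M, a • m = algebraMap k A c • m) (hN : ∀ n : N, a • n = algebraMap k A d • n)
    (hcd : IsUnit (d - c)) (f : M ⟶ N) : f = 0 := by
  ext m
  refine (hcd.map (algebraMap k A)).smul_eq_zero.1 ?_
  rw [map_sub, sub_smul, ← hN, ← map_smul, ← map_smul, hM, sub_self]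

end Representations

namespace TaftDouble

section Presentation

variable (k : Type u) [Field k]

/-- A generator as an element of `D(Λ₂)`. -/
def toGen (s : Gen) : TaftDouble k := RingQuot.mkAlgHom k (Rel k) (gen k s)

lemma adjoin_range_toGen : Algebra.adjoin k (Set.range (toGen k)) = ⊤ := by
  have h := congrArg (Subalgebra.map (RingQuot.mkAlgHom k (Rel k)))
    (FreeAlgebra.adjoin_range_ι k Gen)
  rwa [AlgHom.map_adjoin, ← Set.range_comp, Algebra.map_top,
    (AlgHom.range_eq_top _).2 (RingQuot.mkAlgHom_surjective k (Rel k))] at h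

lemma toGen_x_sq : toGen k .x * toGen k .x = 0 := by
  simpa only [toGen, map_mul, map_zero] using RingQuot.mkAlgHom_rel k (Rel.x_sq (k := k))

lemma toGen_X_sq : toGen k .X * toGen k .X = 0 := by
  simpa only [toGen, map_mul, map_zero] using RingQuot.mkAlgHom_rel k (Rel.X_sq (k := k))

lemma toGen_g_sq : toGen k .g * toGen k .g = 1 := by
  simpa only [toGen, map_mul, map_one] using RingQuot.mkAlgHom_rel k (Rel.g_sq (k := k))

lemma toGen_G_sq : toGen k .G * toGen k .G = 1 := by
  simpa only [toGen, map_mul, map_one] using RingQuot.mkAlgHom_rel k (Rel.G_sq (k := k))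

lemma toGen_g_mul_G : toGen k .g * toGen k .G = toGen k .G * toGen k .g := by
  simpa only [toGen, map_mul] using RingQuot.mkAlgHom_rel k (Rel.gG (k := k))

lemma toGen_g_mul_x : toGen k .g * toGen k .x = -(toGen k .x * toGen k .g) := by
  simpa only [toGen, map_mul, map_neg] using RingQuot.mkAlgHom_rel k (Rel.gx (k := k))

lemma toGen_g_mul_X : toGen k .g * toGen k .X = -(toGen k .X * toGen k .g) := by
  simpa only [toGen, map_mul, map_neg] using RingQuot.mkAlgHom_rel k (Rel.gX (k := k))

lemma toGen_G_mul_x : toGen k .G * toGen k .x = -(toGen k .x * toGen k .G) := by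
  simpa only [toGen, map_mul, map_neg] using RingQuot.mkAlgHom_rel k (Rel.Gx (k := k))

lemma toGen_G_mul_X : toGen k .G * toGen k .X = -(toGen k .X * toGen k .G) := by
  simpa only [toGen, map_mul, map_neg] using RingQuot.mkAlgHom_rel k (Rel.GX (k := k))

lemma toGen_x_mul_X_add :
    toGen k .x * toGen k .X + toGen k .X * toGen k .x = 1 - toGen k .g * toGen k .G := by
  simpa only [toGen, map_mul, map_add, map_sub, map_one] using
    RingQuot.mkAlgHom_rel k (Rel.xX (k := k))

end Presentation

section Lift

variable {k : Type u} [Field k] {B : Type*} [Ring B] [Algebra k B]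

/-- The elements `σ x`, `σ X`, `σ g`, `σ G` of a `k`-algebra satisfy the defining relations of
`D(Λ₂)`. -/
def SatisfiesRel (σ : Gen → B) : Prop :=
  ∀ ⦃a b⦄, Rel k a b → FreeAlgebra.lift k σ a = FreeAlgebra.lift k σ b

/-- The universal property of `D(Λ₂)`. -/
def lift (σ : Gen → B) (hσ : SatisfiesRel (k := k) σ) : TaftDouble k →ₐ[k] B :=
  RingQuot.liftAlgHom k ⟨FreeAlgebra.lift k σ, hσ⟩

@[simp]
lemma lift_toGen (σ : Gen → B) (hσ : SatisfiesRel (k := k) σ) (s : Gen) :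
    lift σ hσ (toGen k s) = σ s :=
  (RingQuot.liftAlgHom_mkAlgHom_apply k _ hσ _).trans (FreeAlgebra.lift_ι_apply σ s)

end Lift

section Extensions

variable {k : Type u} [Field k] {W W' : Type u} [AddCommGroup W] [Module k W]
  [AddCommGroup W'] [Module k W'] {ρ : TaftDouble k →ₐ[k] Module.End k W}
  {ρ' : TaftDouble k →ₐ[k] Module.End k W'} {N : Gen → W →ₗ[k] W'}

/-- The operators by which the generators act on an extension of `ρ` by `ρ'` whose off-diagonal
part is `N`. -/
def extOp (ρ : TaftDouble k →ₐ[k] Module.End k W) (N : Gen → W →ₗ[k] W')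
    (ρ' : TaftDouble k →ₐ[k] Module.End k W') (s : Gen) : Module.End k (W × W') :=
  lowerTriangular (ρ (toGen k s)) (N s) (ρ' (toGen k s))

/-- The extension of `ρ` by `ρ'` with off-diagonal part `N`. -/
def extRep (h : SatisfiesRel (k := k) (extOp ρ N ρ')) :
    TaftDouble k →ₐ[k] Module.End k (W × W') :=
  lift (extOp ρ N ρ') h

@[simp]
lemma extRep_toGen (h : SatisfiesRel (k := k) (extOp ρ N ρ')) (s : Gen) :
    extRep h (toGen k s) = lowerTriangular (ρ (toGen k s)) (N s) (ρ' (toGen k s)) :=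
  lift_toGen _ h s

lemma comp_rep_eq_of_forall_toGen {f : W →ₗ[k] W'}
    (hf : ∀ s, f ∘ₗ ρ (toGen k s) = ρ' (toGen k s) ∘ₗ f) (a : TaftDouble k) :
    f ∘ₗ ρ a = ρ' a ∘ₗ f :=
  comp_rep_eq_of_adjoin_eq_top (adjoin_range_toGen k) (Set.forall_mem_range.2 hf) a

lemma inr_comp_rep (h : SatisfiesRel (k := k) (extOp ρ N ρ')) (a : TaftDouble k) :
    LinearMap.inr k W W' ∘ₗ ρ' a = extRep h a ∘ₗ LinearMap.inr k W W' :=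
  comp_rep_eq_of_forall_toGen (fun s => by ext <;> simp) a

lemma fst_comp_extRep (h : SatisfiesRel (k := k) (extOp ρ N ρ')) (a : TaftDouble k) :
    LinearMap.fst k W W' ∘ₗ extRep h a = ρ a ∘ₗ LinearMap.fst k W W' :=
  comp_rep_eq_of_forall_toGen (fun s => by ext <;> simp) a

/-- The inclusion of the submodule `W'` in the extension. -/
noncomputable def extι (h : SatisfiesRel (k := k) (extOp ρ N ρ')) :
    moduleOfRep ρ' ⟶ moduleOfRep (extRep h) :=
  moduleOfRep.map (LinearMap.inr k W W') (inr_comp_rep h)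

/-- The projection of the extension onto the quotient module `W`. -/
noncomputable def extπ (h : SatisfiesRel (k := k) (extOp ρ N ρ')) :
    moduleOfRep (extRep h) ⟶ moduleOfRep ρ :=
  moduleOfRep.map (LinearMap.fst k W W') (fst_comp_extRep h)

lemma extι_comp_extπ (h : SatisfiesRel (k := k) (extOp ρ N ρ')) : extι h ≫ extπ h = 0 := rfl

lemma shortExact_extι_extπ (h : SatisfiesRel (k := k) (extOp ρ N ρ')) :
    (ShortComplex.mk (extι h) (extπ h) (extι_comp_extπ h)).ShortExact :=
  ModuleCat.shortComplex_shortExact _ (Function.Exact.inr_fst (R := k) (M := W) (N := W'))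
    (LinearMap.inr_injective (R := k) (M := W) (M₂ := W'))
    (LinearMap.fst_surjective (R := k) (M := W) (M₂ := W'))

end Extensions

/-- The square roots of unity in `k`, by which `g` and `G` act on the one-dimensional modules. -/
@[ext]
structure Sign (k : Type u) [Field k] where
  val : k
  val_mul_val : val * val = 1

namespace Sign

variable {k : Type u} [Field k]

attribute [simp] val_mul_val

instance : One (Sign k) := ⟨⟨1, one_mul 1⟩⟩

instance : InvolutiveNeg (Sign k) where
  neg ε := ⟨-ε.val, by rw [neg_mul_neg, ε.val_mul_val]⟩
  neg_neg ε := Sign.ext (neg_neg ε.val)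

@[simp]
lemma val_neg (ε : Sign k) : (-ε).val = -ε.val := rfl

lemma isUnit_val_neg_sub_val (h2 : (2 : k) ≠ 0) (ε : Sign k) : IsUnit ((-ε).val - ε.val) := by
  have hε : ε.val ≠ 0 := left_ne_zero_of_mul_eq_one ε.val_mul_val
  have h : (-ε).val - ε.val = -(2 * ε.val) := by rw [val_neg]; ring
  rw [h]
  exact (neg_ne_zero.2 (mul_ne_zero h2 hε)).isUnit

end Sign

section Modules

variable {k : Type u} [Field k]

/-- The one-dimensional representation on which `g` and `G` act as `ε`. -/
def sgnRep (ε : Sign k) : TaftDouble k →ₐ[k] Module.End k k :=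
  (Algebra.lmul k k).comp (character k ε.val ε.val_mul_val)

/-- The one-dimensional module on which `g` and `G` act as `ε`. -/
noncomputable def sgn (ε : Sign k) : ModuleCat.{u} (TaftDouble k) := moduleOfRep (sgnRep ε)

lemma triv_eq_sgn : triv k = sgn 1 := rfl

lemma kMinus_eq_sgn : kMinus k = sgn (-1) := rfl

lemma character_toGen (ε : Sign k) (s : Gen) :
    character k ε.val ε.val_mul_val (toGen k s) =
      match s with
      | .x | .X => 0
      | .g | .G => ε.val := by
  rw [character, toGen, RingQuot.liftAlgHom_mkAlgHom_apply, FreeAlgebra.lift_ι_apply]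

@[simp]
lemma sgnRep_toGen (ε : Sign k) (s : Gen) :
    sgnRep ε (toGen k s) =
      match s with
      | .x | .X => 0
      | .g | .G => ε.val • LinearMap.id := by
  ext
  cases s <;> simp [sgnRep, character_toGen]

lemma hom_sgn_neg_eq_zero (h2 : (2 : k) ≠ 0) (ε : Sign k) (f : sgn ε ⟶ sgn (-ε)) : f = 0 := by
  have hg (δ : Sign k) (m : sgn δ) :
      toGen k .g • m = algebraMap k (TaftDouble k) δ.val • m := by
    change sgnRep δ (toGen k .g) m = sgnRep δ (algebraMap k _ δ.val) m
    rw [AlgHom.commutes, sgnRep_toGen]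
    rfl
  exact hom_eq_zero_of_isUnit_sub (hg ε) (hg (-ε)) (ε.isUnit_val_neg_sub_val h2) f

/-- The off-diagonal part of `planeRep`. -/
def planeGlue (s t : k) : Gen → k →ₗ[k] k
  | .x => s • LinearMap.id
  | .X => t • LinearMap.id
  | .g | .G => 0

lemma satisfiesRel_extOp_planeGlue (ε : Sign k) (s t : k) :
    SatisfiesRel (k := k) (extOp (sgnRep ε) (planeGlue s t) (sgnRep (-ε))) := by
  intro a b h
  cases h <;> ext <;> simp [extOp, planeGlue, mul_comm]

/-- The extension of `sgn ε` by `sgn (-ε)` in which `x` and `X` multiply the top vector by `s`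
and `t` times the bottom vector. -/
def planeRep (ε : Sign k) (s t : k) : TaftDouble k →ₐ[k] Module.End k (k × k) :=
  extRep (satisfiesRel_extOp_planeGlue ε s t)

/-- The module of `planeRep ε s t`. -/
noncomputable def plane (ε : Sign k) (s t : k) : ModuleCat.{u} (TaftDouble k) :=
  moduleOfRep (planeRep ε s t)

/-- The inclusion of the bottom vector. -/
noncomputable def planeι (ε : Sign k) (s t : k) : sgn (-ε) ⟶ plane ε s t :=
  extι (satisfiesRel_extOp_planeGlue ε s t)

/-- The projection onto the top vector. -/
noncomputable def planeπ (ε : Sign k) (s t : k) : plane ε s t ⟶ sgn ε :=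
  extπ (satisfiesRel_extOp_planeGlue ε s t)

lemma planeι_comp_planeπ (ε : Sign k) (s t : k) : planeι ε s t ≫ planeπ ε s t = 0 :=
  extι_comp_extπ _

lemma shortExact_planeι_planeπ (ε : Sign k) (s t : k) :
    (ShortComplex.mk (planeι ε s t) (planeπ ε s t) (planeι_comp_planeπ ε s t)).ShortExact :=
  shortExact_extι_extπ _

@[simp]
lemma planeRep_toGen (ε : Sign k) (s t : k) (r : Gen) :
    planeRep ε s t (toGen k r) =
      lowerTriangular (sgnRep ε (toGen k r)) (planeGlue s t r) (sgnRep (-ε) (toGen k r)) :=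
  extRep_toGen _ r

/-- The off-diagonal part of `coverRep`. The sign comes from `X x v = -x X v`, which is the relation
`xX + Xx = 1 - gG` on a vector `v` on which `gG` acts trivially. -/
def coverGlue : Gen → k × k →ₗ[k] k × k
  | .X => LinearMap.id.prodMap (-LinearMap.id)
  | .x | .g | .G => 0

lemma satisfiesRel_extOp_coverGlue (ε : Sign k) :
    SatisfiesRel (k := k) (extOp (planeRep ε 1 0) coverGlue (planeRep (-ε) 1 0)) := by
  intro a b h
  cases h <;> refine LinearMap.ext fun w => ?_ <;>
    simp [extOp, planeGlue, coverGlue, Prod.ext_iff, ← mul_assoc, mul_comm]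

/-- The projective cover of `sgn ε` in the basis `v, x v, X v, x X v`, as an extension of
`planeRep ε 1 0` by `planeRep (-ε) 1 0`. -/
def coverRep (ε : Sign k) : TaftDouble k →ₐ[k] Module.End k ((k × k) × (k × k)) :=
  extRep (satisfiesRel_extOp_coverGlue ε)

/-- The projective cover of `sgn ε`. -/
noncomputable def cover (ε : Sign k) : ModuleCat.{u} (TaftDouble k) := moduleOfRep (coverRep ε)

/-- The inclusion of the submodule generated by `X v`. -/
noncomputable def coverι (ε : Sign k) : plane (-ε) 1 0 ⟶ cover ε :=
  extι (satisfiesRel_extOp_coverGlue ε)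

/-- The quotient map by the submodule generated by `X v`. -/
noncomputable def coverπ (ε : Sign k) : cover ε ⟶ plane ε 1 0 :=
  extπ (satisfiesRel_extOp_coverGlue ε)

lemma coverι_comp_coverπ (ε : Sign k) : coverι ε ≫ coverπ ε = 0 :=
  extι_comp_extπ _

lemma shortExact_coverι_coverπ (ε : Sign k) :
    (ShortComplex.mk (coverι ε) (coverπ ε) (coverι_comp_coverπ ε)).ShortExact :=
  shortExact_extι_extπ _

@[simp]
lemma coverRep_toGen (ε : Sign k) (r : Gen) :
    coverRep ε (toGen k r) = lowerTriangular (planeRep ε 1 0 (toGen k r)) (coverGlue r)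
      (planeRep (-ε) 1 0 (toGen k r)) :=
  extRep_toGen _ r

lemma fst_prodMap_fst_comp_coverRep (ε : Sign k) (a : TaftDouble k) :
    (LinearMap.fst k k k).prodMap (LinearMap.fst k k k) ∘ₗ coverRep ε a =
      planeRep ε 0 1 a ∘ₗ (LinearMap.fst k k k).prodMap (LinearMap.fst k k k) := by
  refine comp_rep_eq_of_forall_toGen (fun r => LinearMap.ext fun w => ?_) a
  cases r <;> simp [planeGlue, coverGlue]

/-- The quotient map by the submodule generated by `x v`. -/
noncomputable def coverToPlane (ε : Sign k) : cover ε ⟶ plane ε 0 1 :=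
  moduleOfRep.map _ (fst_prodMap_fst_comp_coverRep ε)

lemma planeπ_comp_planeι (ε : Sign k) :
    planeπ (-ε) 1 0 ≫ planeι ε 0 1 = coverι ε ≫ coverToPlane ε :=
  moduleOfRep.map_comp_map_eq (fst_comp_extRep _) (inr_comp_rep _) (inr_comp_rep _)
    (fst_prodMap_fst_comp_coverRep ε) (by ext <;> simp)

lemma coverToPlane_comp_planeπ (ε : Sign k) :
    coverToPlane ε ≫ planeπ ε 0 1 = coverπ ε ≫ planeπ ε 1 0 :=
  moduleOfRep.map_comp_map_eq (fst_prodMap_fst_comp_coverRep ε) (fst_comp_extRep _)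
    (fst_comp_extRep _) (fst_comp_extRep _) rfl

/-- `coverToPlane` as a morphism of short exact sequences. -/
noncomputable def coverToPlaneSequence (ε : Sign k) :
    ShortComplex.mk (coverι ε) (coverπ ε) (coverι_comp_coverπ ε) ⟶
      ShortComplex.mk (planeι ε 0 1) (planeπ ε 0 1) (planeι_comp_planeπ ε 0 1) :=
  ShortComplex.homMk (planeπ (-ε) 1 0) (coverToPlane ε) (planeπ ε 1 0) (planeπ_comp_planeι ε)
    (coverToPlane_comp_planeπ ε)

end Modules

section Projective

variable {k : Type u} [Field k]

/-- A vector `m` on which both `g` and `G` act as `ε`. -/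
structure IsWeightVector {W : Type*} [AddCommGroup W] [Module k W]
    (ρ : TaftDouble k →ₐ[k] Module.End k W) (ε : Sign k) (m : W) : Prop where
  g : ρ (toGen k .g) m = ε.val • m
  G : ρ (toGen k .G) m = ε.val • m

namespace IsWeightVector

variable {W : Type*} [AddCommGroup W] [Module k W] {ρ : TaftDouble k →ₐ[k] Module.End k W}
  {ε : Sign k} {m : W}

lemma rep_x (h : IsWeightVector ρ ε m) : IsWeightVector ρ (-ε) (ρ (toGen k .x) m) where
  g := rep_apply_rep_apply_eq_neg_smul (toGen_g_mul_x k) h.g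
  G := rep_apply_rep_apply_eq_neg_smul (toGen_G_mul_x k) h.G

lemma rep_X (h : IsWeightVector ρ ε m) : IsWeightVector ρ (-ε) (ρ (toGen k .X) m) where
  g := rep_apply_rep_apply_eq_neg_smul (toGen_g_mul_X k) h.g
  G := rep_apply_rep_apply_eq_neg_smul (toGen_G_mul_X k) h.G

lemma rep_X_rep_x (h : IsWeightVector ρ ε m) :
    ρ (toGen k .X) (ρ (toGen k .x) m) = -ρ (toGen k .x) (ρ (toGen k .X) m) := by
  have hgG : ρ (toGen k .g) (ρ (toGen k .G) m) = m := by
    rw [h.G, map_smul, h.g, smul_smul, ε.val_mul_val, one_smul]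
  have hxX := congrArg (fun a => ρ a m) (toGen_x_mul_X_add k)
  simp only [map_add, map_sub, map_mul, map_one, LinearMap.add_apply, LinearMap.sub_apply,
    Module.End.mul_apply, Module.End.one_apply, hgG, sub_self] at hxX
  exact eq_neg_of_add_eq_zero_right hxX

end IsWeightVector

section CoverLift

variable {W : Type u} [AddCommGroup W] [Module k W]

/-- The linear map that sends the basis `v, x v, X v, x X v` of the projective cover to
`m, x m, X m, x X m`. -/
def coverLift (ρ : TaftDouble k →ₐ[k] Module.End k W) (m : W) : (k × k) × (k × k) →ₗ[k] W :=
  ((LinearMap.toSpanSingleton k W m).coprod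
    (LinearMap.toSpanSingleton k W (ρ (toGen k .x) m))).coprod
  ((LinearMap.toSpanSingleton k W (ρ (toGen k .X) m)).coprod
    (LinearMap.toSpanSingleton k W (ρ (toGen k .x) (ρ (toGen k .X) m))))

lemma coverLift_apply (ρ : TaftDouble k →ₐ[k] Module.End k W) (m : W) (w : (k × k) × (k × k)) :
    coverLift ρ m w = w.1.1 • m + w.1.2 • ρ (toGen k .x) m +
      (w.2.1 • ρ (toGen k .X) m + w.2.2 • ρ (toGen k .x) (ρ (toGen k .X) m)) := rfl

lemma coverLift_comp_coverRep {ρ : TaftDouble k →ₐ[k] Module.End k W} {ε : Sign k} {m : W}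
    (h : IsWeightVector ρ ε m) (a : TaftDouble k) :
    coverLift ρ m ∘ₗ coverRep ε a = ρ a ∘ₗ coverLift ρ m := by
  have hxx (w : W) : ρ (toGen k .x) (ρ (toGen k .x) w) = 0 := by
    rw [← Module.End.mul_apply, ← map_mul, toGen_x_sq, map_zero, LinearMap.zero_apply]
  have hXX (w : W) : ρ (toGen k .X) (ρ (toGen k .X) w) = 0 := by
    rw [← Module.End.mul_apply, ← map_mul, toGen_X_sq, map_zero, LinearMap.zero_apply]
  have hXxX : ρ (toGen k .X) (ρ (toGen k .x) (ρ (toGen k .X) m)) = 0 := by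
    rw [h.rep_X.rep_X_rep_x, hXX, map_zero, neg_zero]
  refine comp_rep_eq_of_forall_toGen (fun s => LinearMap.ext fun w => ?_) a
  simp only [LinearMap.comp_apply, coverLift_apply, map_add, map_smul]
  cases s
  · simp [hxx, planeGlue, coverGlue]
  · simp [hXX, hXxX, h.rep_X_rep_x, planeGlue, coverGlue]
  · simp only [coverRep_toGen, planeRep_toGen, sgnRep_toGen, planeGlue, coverGlue,
      lowerTriangular_apply, LinearMap.smul_apply, LinearMap.id_apply, LinearMap.zero_apply,
      smul_eq_mul, zero_add, neg_mul, neg_neg, neg_smul, smul_neg, Sign.val_neg, h.g,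
      h.rep_x.g, h.rep_X.g, h.rep_X.rep_x.g]
    module
  · simp only [coverRep_toGen, planeRep_toGen, sgnRep_toGen, planeGlue, coverGlue,
      lowerTriangular_apply, LinearMap.smul_apply, LinearMap.id_apply, LinearMap.zero_apply,
      smul_eq_mul, zero_add, neg_mul, neg_neg, neg_smul, smul_neg, Sign.val_neg, h.G,
      h.rep_x.G, h.rep_X.G, h.rep_X.rep_x.G]
    module

end CoverLift

/-- The idempotent of `k⟨g, G⟩` that projects onto the vectors of weight `ε`. -/
noncomputable def idem (ε : Sign k) : TaftDouble k :=
  (4⁻¹ : k) • ((1 + ε.val • toGen k .g) * (1 + ε.val • toGen k .G))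

lemma isWeightVector_idem (ε : Sign k) :
    IsWeightVector (Algebra.lmul k (TaftDouble k)) ε (idem ε) := by
  have absorb {a : TaftDouble k} (ha : a * a = 1) :
      a * (1 + ε.val • a) = ε.val • (1 + ε.val • a) := by
    rw [mul_add, mul_one, mul_smul_comm, ha, smul_add, smul_smul, ε.val_mul_val, one_smul, add_comm]
  have comm : toGen k .G * (1 + ε.val • toGen k .g) = (1 + ε.val • toGen k .g) * toGen k .G := by
    rw [mul_add, add_mul, mul_smul_comm, smul_mul_assoc, toGen_g_mul_G, mul_one, one_mul]
  constructor
  · change toGen k .g * idem ε = ε.val • idem ε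
    rw [idem, mul_smul_comm, ← mul_assoc, absorb (toGen_g_sq k), smul_mul_assoc, smul_comm]
  · change toGen k .G * idem ε = ε.val • idem ε
    rw [idem, mul_smul_comm, ← mul_assoc, comm, mul_assoc, absorb (toGen_G_sq k), mul_smul_comm,
      smul_comm]

lemma IsWeightVector.rep_idem {W : Type*} [AddCommGroup W] [Module k W]
    {ρ : TaftDouble k →ₐ[k] Module.End k W} {ε : Sign k} {m : W} (h2 : (2 : k) ≠ 0)
    (h : IsWeightVector ρ ε m) : ρ (idem ε) m = m := by
  have hg : ρ (1 + ε.val • toGen k .g) m = (2 : k) • m := by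
    simp [h.g, smul_smul, two_smul]
  have hG : ρ (1 + ε.val • toGen k .G) m = (2 : k) • m := by
    simp [h.G, smul_smul, two_smul]
  have h4 : (4 : k)⁻¹ * 2 * 2 = 1 := by
    rw [mul_assoc, show (4 : k) = 2 * 2 by norm_num]
    exact inv_mul_cancel₀ (mul_ne_zero h2 h2)
  rw [idem, map_smul, map_mul, LinearMap.smul_apply, Module.End.mul_apply, hG, map_smul, hg,
    smul_smul, smul_smul, h4, one_smul]

lemma isWeightVector_coverRep (ε : Sign k) : IsWeightVector (coverRep ε) ε ((1, 0), 0) where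
  g := by simp [planeGlue, coverGlue]
  G := by simp [planeGlue, coverGlue]

lemma coverRep_coverLift_idem_apply (h2 : (2 : k) ≠ 0) (ε : Sign k) (w : (k × k) × (k × k)) :
    coverRep ε (coverLift (Algebra.lmul k (TaftDouble k)) (idem ε) w) ((1, 0), 0) = w := by
  simp [coverLift_apply, (isWeightVector_coverRep ε).rep_idem h2, planeGlue, coverGlue,
    Prod.ext_iff]

theorem projective_cover (h2 : (2 : k) ≠ 0) (ε : Sign k) : Projective (cover ε) := by
  let i : cover ε →ₗ[TaftDouble k] TaftDouble k :=
    (moduleOfRep.map (coverLift (Algebra.lmul k (TaftDouble k)) (idem ε))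
      (coverLift_comp_coverRep (isWeightVector_idem ε))).hom
  let v : cover ε := (((1, 0), 0) : (k × k) × (k × k))
  have : Module.Projective (TaftDouble k) (cover ε) :=
    Module.Projective.of_split i (LinearMap.toSpanSingleton _ _ v)
      (LinearMap.ext (coverRep_coverLift_idem_apply h2 ε))
  exact (IsProjective.iff_projective (cover ε)).1 this

end Projective

section Generation

variable {k : Type u} [Field k] {T : ModuleCat.{u} (TaftDouble k)}

lemma planeι_comp_eq_zero (hT : ∀ t : T, toGen k .x • t = 0) (ε : Sign k)
    (f : plane ε 1 0 ⟶ T) : planeι ε 1 0 ≫ f = 0 := by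
  ext (m : k)
  let v : plane ε 1 0 := ((m, 0) : k × k)
  have hm : (planeι ε 1 0).hom m = toGen k .x • v := by
    change ((0, m) : k × k) = planeRep ε 1 0 (toGen k .x) (m, 0)
    simp [planeGlue]
  exact (congrArg f.hom hm).trans ((map_smul f.hom _ _).trans (hT _))

theorem precomp_planeπ_surjective (h2 : (2 : k) ≠ 0) (hT : ∀ t : T, toGen k .x • t = 0)
    (n : ℕ) (ε : Sign k) :
    Function.Surjective ((Ext.mk₀.{u} (planeπ ε 1 0)).precomp T (zero_add n)) := by
  induction n generalizing ε with
  | zero =>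
    intro α
    obtain ⟨f, rfl⟩ := (Ext.mk₀_bijective _ _).2 α
    refine Ext.contravariant_sequence_exact₂ (shortExact_planeι_planeπ ε 1 0) T (Ext.mk₀ f) ?_
    rw [Ext.mk₀_comp_mk₀, planeι_comp_eq_zero hT, Ext.mk₀_zero]
  | succ n ih =>
    have := projective_cover h2 ε
    exact (precomp_extClass_surjective_of_projective (shortExact_coverι_coverπ ε)
      (shortExact_planeι_planeπ ε 0 1) (coverToPlaneSequence ε) (ih (-ε))).of_comp

theorem factorsThroughExtOne_sgn (h2 : (2 : k) ≠ 0) (hT : ∀ t : T, toGen k .x • t = 0)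
    (ε : Sign k) : FactorsThroughExtOne.{u} (sgn ε) (sgn (-ε)) T := by
  have := projective_cover h2 ε
  refine fun n => top_le_iff.1 fun α _ => ?_
  have hU := shortExact_planeι_planeπ ε 1 0
  have hV := shortExact_planeι_planeπ ε 0 1
  obtain ⟨β, γ, rfl⟩ := exists_eq_extClass_comp_add_comp hU hV.extClass
    (precomp_extClass_surjective_of_projective (shortExact_coverι_coverπ ε) hV
      (coverToPlaneSequence ε) (precomp_planeπ_surjective h2 hT n (-ε))) α
  exact add_mem (AddSubgroup.subset_closure ⟨hU.extClass, β, rfl⟩)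
    (AddSubgroup.subset_closure ⟨hV.extClass, γ, rfl⟩)

lemma toGen_x_smul_sgn (ε : Sign k) (t : sgn ε) : toGen k .x • t = 0 := by
  change sgnRep ε (toGen k .x) t = 0
  rw [sgnRep_toGen]
  rfl

theorem span_range_of_one_sgn_eq_top (h2 : (2 : k) ≠ 0) (ε : Sign k) :
    Submodule.span (ExtStar (sgn (-ε)) (sgn (-ε)))
        (Set.range (ExtStar.of (sgn ε) (sgn (-ε)) 1)) = ⊤ ∧
      Submodule.span (ExtStar (sgn ε) (sgn ε))ᵐᵒᵖ
        (Set.range (ExtStar.of (sgn ε) (sgn (-ε)) 1)) = ⊤ := by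
  have h₀ := hom_sgn_neg_eq_zero h2 ε
  have h := factorsThroughExtOne_sgn h2 (toGen_x_smul_sgn (-ε)) ε
  have h' := factorsThroughExtOne_sgn h2 (toGen_x_smul_sgn (-ε)) (-ε)
  rw [neg_neg] at h'
  exact ⟨ExtStar.span_left_range_of_one_eq_top h₀ h,
    ExtStar.span_right_range_of_one_eq_top h₀ h h'⟩

end Generation

end TaftDouble

theorem mainTheorem6_general (k : Type u) [Field k] (hk : ringChar k ≠ 2) :
    (Submodule.span (ExtStar (TaftDouble.kMinus k) (TaftDouble.kMinus k))
        (Set.range (ExtStar.of (TaftDouble.triv k) (TaftDouble.kMinus k) 1)) = ⊤ ∧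
      Submodule.span (ExtStar (TaftDouble.triv k) (TaftDouble.triv k))ᵐᵒᵖ
        (Set.range (ExtStar.of (TaftDouble.triv k) (TaftDouble.kMinus k) 1)) = ⊤) ∧
    (Submodule.span (ExtStar (TaftDouble.triv k) (TaftDouble.triv k))
        (Set.range (ExtStar.of (TaftDouble.kMinus k) (TaftDouble.triv k) 1)) = ⊤ ∧
      Submodule.span (ExtStar (TaftDouble.kMinus k) (TaftDouble.kMinus k))ᵐᵒᵖ
        (Set.range (ExtStar.of (TaftDouble.kMinus k) (TaftDouble.triv k) 1)) = ⊤) := by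
  have h2 : (2 : k) ≠ 0 := Ring.two_ne_zero hk
  have h := TaftDouble.span_range_of_one_sgn_eq_top h2 (-1)
  rw [neg_neg] at h
  rw [TaftDouble.triv_eq_sgn, TaftDouble.kMinus_eq_sgn]
  exact ⟨TaftDouble.span_range_of_one_sgn_eq_top h2 1, h⟩

theorem mainTheorem6 (k : Type u) [Field k] [IsAlgClosed k] (hk : ringChar k ≠ 2) :
    (Submodule.span (ExtStar (TaftDouble.kMinus k) (TaftDouble.kMinus k))
        (Set.range (ExtStar.of (TaftDouble.triv k) (TaftDouble.kMinus k) 1)) = ⊤ ∧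
      Submodule.span (ExtStar (TaftDouble.triv k) (TaftDouble.triv k))ᵐᵒᵖ
        (Set.range (ExtStar.of (TaftDouble.triv k) (TaftDouble.kMinus k) 1)) = ⊤) ∧
    (Submodule.span (ExtStar (TaftDouble.triv k) (TaftDouble.triv k))
        (Set.range (ExtStar.of (TaftDouble.kMinus k) (TaftDouble.triv k) 1)) = ⊤ ∧
      Submodule.span (ExtStar (TaftDouble.kMinus k) (TaftDouble.kMinus k))ᵐᵒᵖ
        (Set.range (ExtStar.of (TaftDouble.kMinus k) (TaftDouble.triv k) 1)) = ⊤) :=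
  mainTheorem6_general k hk
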